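/- A \emph{plane poset} is a finite set $P$ with two partial orders $\leq_h$ and $\leq_r$ such that, for all $x\neq y$ in $P$, $x$ and $y$ are comparable for $\leq_h$ if, and only if, they are not comparable for $\leq_r$. The relation "$x\leq y$ if $x\leq_h y$ or $x\leq_r y$" is then a total order on $P$. For $n\geq 0$, let $\mathcal{PP}(n)$ be the set of isomorphism classes of plane posets of cardinality $n$. For $P,Q\in\mathcal{PP}(n)$ let $\theta_{P,Q}:P\to Q$ be the unique bijection which is increasing for the total orders, and put $P\leq Q$ if, for all $x,y\in P$, $\theta_{P,Q}(x)\leq_h\theta_{P,Q}(y)$ in $Q$ implies $x\leq_h y$ in $P$; this is a partial order on $\mathcal{PP}(n)$. A \emph{plane forest} of degree $n$ is an element of $\mathcal{PP}(n)$ which does not contain, as a plane subposet (a subset with the restrictions of both orders), the plane poset $\{a,b,c\}$ with $a<_h c$, $b<_h c$, $a<_r b$; let $\mathcal{PF}(n)\subseteq\mathcal{PP}(n)$ be the set of plane forests of degree $n$. \textbf{Corollary.} For all $n\geq 0$, the set $\mathcal{PF}(n)$, partially ordered by the restriction of $\leq$, is isomorphic as a poset to the Tamari poset on plane binary trees with $n+1$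 leaves (that is, with $n$ internal vertices), where $s\leq t$ if $t$ is obtained from $s$ by a finite number of rotations, each replacing a subtree $((A,B),C)$ by $(A,(B,C))$. -/

import Mathlib

/-- A double poset: a finite set with two partial orders. -/
structure DoublePoset where
  carrier : Type
  finite : Finite carrier
  leH : carrier → carrier → Prop
  leR : carrier → carrier → Prop
  partialOrderH : IsPartialOrder carrier leH
  partialOrderR : IsPartialOrder carrier leR

/-- A plane poset: two distinct elements are comparable for `leH` if and only if they are
not comparable for `leR`. -/
structure PlanePoset extends DoublePoset where
  incompat : ∀ x y : carrier, x ≠ y → ((leH x y ∨ leH y x) ↔ ¬ (leR x y ∨ leR y x))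

namespace PlanePoset

/-- The total order of a plane poset: `x ≤ y` if `x ≤_h y` or `x ≤_r y`. -/
def le (P : PlanePoset) (x y : P.carrier) : Prop := P.leH x y ∨ P.leR x y

section basic
variable (P : PlanePoset)

theorem leH_refl (x : P.carrier) : P.leH x x := P.partialOrderH.refl x
theorem leR_refl (x : P.carrier) : P.leR x x := P.partialOrderR.refl x

theorem eq_of_comparable {x y : P.carrier} (h : P.leH x y ∨ P.leH y x)
    (r : P.leR x y ∨ P.leR y x) : x = y := by
  by_contra hne
  exact (P.incompat x y hne).1 h r

theorem le_refl (x : P.carrier) : P.le x x := Or.inl (P.leH_refl x)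

theorem le_total (x y : P.carrier) : P.le x y ∨ P.le y x := by
  by_cases hxy : x = y
  · subst hxy; exact Or.inl (P.le_refl x)
  · have := P.incompat x y hxy
    unfold le; tauto

theorem le_antisymm {x y : P.carrier} (h : P.le x y) (h' : P.le y x) : x = y := by
  rcases h with h | h <;> rcases h' with h' | h'
  · exact P.partialOrderH.antisymm _ _ h h'
  · exact P.eq_of_comparable (Or.inl h) (Or.inr h')
  · exact P.eq_of_comparable (Or.inr h') (Or.inl h)
  · exact P.partialOrderR.antisymm _ _ h h'

theorem le_trans {x y z : P.carrier} (h : P.le x y) (h' : P.le y z) : P.le x z := by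
  rcases h with h | h <;> rcases h' with h' | h'
  · exact Or.inl (P.partialOrderH.trans _ _ _ h h')
  · rcases P.le_total x z with k | k | k
    · exact k
    · have := P.eq_of_comparable (Or.inl (P.partialOrderH.trans _ _ _ k h)) (Or.inr h')
      subst this; exact Or.inl h
    · have := P.eq_of_comparable (Or.inl h) (Or.inr (P.partialOrderR.trans _ _ _ h' k))
      subst this; exact Or.inr h'
  · rcases P.le_total x z with k | k | k
    · exact k
    · have := P.eq_of_comparable (Or.inr (P.partialOrderH.trans _ _ _ h' k)) (Or.inl h)
      subst this; exact Or.inl h'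
    · have := P.eq_of_comparable (Or.inl h') (Or.inr (P.partialOrderR.trans _ _ _ k h))
      subst this; exact Or.inr h
  · exact Or.inr (P.partialOrderR.trans _ _ _ h h')

/-- The carrier with its total order, as a linear order. -/
noncomputable abbrev linearOrder : LinearOrder P.carrier where
  le := P.le
  le_refl := P.le_refl
  le_trans _ _ _ := P.le_trans
  le_antisymm _ _ := P.le_antisymm
  le_total := P.le_total
  toDecidableLE := Classical.decRel _

end basic

/-- A bijection that is increasing for the total orders. -/
def Increasing (P Q : PlanePoset) (f : P.carrier ≃ Q.carrier) : Prop :=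
  ∀ x y : P.carrier, P.le x y → Q.le (f x) (f y)

theorem Increasing.le_iff {P Q : PlanePoset} {f : P.carrier ≃ Q.carrier}
    (hf : Increasing P Q f) (x y : P.carrier) : Q.le (f x) (f y) ↔ P.le x y := by
  refine ⟨fun h => ?_, hf x y⟩
  rcases P.le_total x y with k | k
  · exact k
  · have := f.injective (Q.le_antisymm h (hf _ _ k))
    subst this; exact k

/-- Between plane posets of the same cardinality there is a unique increasing bijection. -/
theorem existsUnique_increasing (P Q : PlanePoset)
    (h : Nat.card P.carrier = Nat.card Q.carrier) :
    ∃! f : P.carrier ≃ Q.carrier, Increasing P Q f := by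
  let := P.linearOrder
  let := Q.linearOrder
  have := P.finite
  have := Q.finite
  let := Fintype.ofFinite P.carrier
  let := Fintype.ofFinite Q.carrier
  let e₁ := Fintype.orderIsoFinOfCardEq P.carrier (Nat.card_eq_fintype_card (α := P.carrier)).symm
  let e₂ := Fintype.orderIsoFinOfCardEq Q.carrier
    ((Nat.card_eq_fintype_card (α := Q.carrier)).symm.trans h.symm)
  let e : P.carrier ≃o Q.carrier := e₁.symm.trans e₂
  refine ⟨e.toEquiv, fun x y hxy => e.monotone hxy, fun f hf => ?_⟩
  let f' : P.carrier ≃o Q.carrier := ⟨f, fun {x y} => hf.le_iff x y⟩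
  have : f' = e := Subsingleton.elim _ _
  exact congrArg RelIso.toEquiv this

/-- The unique increasing bijection `θ_{P,Q}` between plane posets of the same cardinality. -/
noncomputable def theta (P Q : PlanePoset) (h : Nat.card P.carrier = Nat.card Q.carrier) :
    P.carrier ≃ Q.carrier :=
  (existsUnique_increasing P Q h).choose

theorem theta_increasing (P Q : PlanePoset) (h : Nat.card P.carrier = Nat.card Q.carrier) :
    Increasing P Q (theta P Q h) :=
  (existsUnique_increasing P Q h).choose_spec.1

theorem eq_theta {P Q : PlanePoset} (h : Nat.card P.carrier = Nat.card Q.carrier)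
    {f : P.carrier ≃ Q.carrier} (hf : Increasing P Q f) : f = theta P Q h :=
  (existsUnique_increasing P Q h).choose_spec.2 f hf

/-- `f` is an isomorphism of plane posets. -/
def IsIso (P Q : PlanePoset) (f : P.carrier ≃ Q.carrier) : Prop :=
  (∀ x y, P.leH x y ↔ Q.leH (f x) (f y)) ∧ (∀ x y, P.leR x y ↔ Q.leR (f x) (f y))

theorem IsIso.symm {P Q : PlanePoset} {f : P.carrier ≃ Q.carrier} (hf : IsIso P Q f) :
    IsIso Q P f.symm :=
  ⟨fun x y => by simp [hf.1], fun x y => by simp [hf.2]⟩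

theorem IsIso.trans {P Q R : PlanePoset} {f : P.carrier ≃ Q.carrier} {g : Q.carrier ≃ R.carrier}
    (hf : IsIso P Q f) (hg : IsIso Q R g) : IsIso P R (f.trans g) :=
  ⟨fun x y => (hf.1 x y).trans (hg.1 _ _), fun x y => (hf.2 x y).trans (hg.2 _ _)⟩

theorem IsIso.increasing {P Q : PlanePoset} {f : P.carrier ≃ Q.carrier} (hf : IsIso P Q f) :
    Increasing P Q f :=
  fun x y h => h.imp (hf.1 x y).1 (hf.2 x y).1

/-- `P` is contained in `Q` as a plane subposet, up to isomorphism: there is an injection along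
which both orders of `P` are the restrictions of those of `Q`. -/
def IsContainedIn (P Q : PlanePoset) : Prop :=
  ∃ f : P.carrier → Q.carrier, Function.Injective f ∧
    (∀ x y, P.leH x y ↔ Q.leH (f x) (f y)) ∧ (∀ x y, P.leR x y ↔ Q.leR (f x) (f y))

/-- The plane poset on `{0, 1, 2}` with `0 <_h 2`, `1 <_h 2` and `0 <_r 1`. Its Hasse graph for
`≤_h` has two minimal elements, `0` on the left of `1`, both covered by `2`. -/
def wedge : PlanePoset where
  carrier := Fin 3
  finite := inferInstance
  leH x y := x = y ∨ y = 2
  leR x y := x = y ∨ (x = 0 ∧ y = 1)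
  partialOrderH :=
    { refl := by decide, trans := by decide, antisymm := by decide }
  partialOrderR :=
    { refl := by decide, trans := by decide, antisymm := by decide }
  incompat := by decide

/-- A plane forest is a plane poset that does not contain `wedge` as a plane subposet. -/
def IsForest (P : PlanePoset) : Prop := ¬ IsContainedIn wedge P

theorem IsIso.isForest {P Q : PlanePoset} {f : P.carrier ≃ Q.carrier} (hf : IsIso P Q f)
    (hP : P.IsForest) : Q.IsForest := by
  rintro ⟨g, hg, hH, hR⟩
  exact hP ⟨fun x => f.symm (g x), f.symm.injective.comp hg,
    fun x y => (hH x y).trans (hf.symm.1 _ _), fun x y => (hR x y).trans (hf.symm.2 _ _)⟩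

/-- Plane posets of cardinality `n`. -/
def OfCard (n : ℕ) : Type 1 := {P : PlanePoset // Nat.card P.carrier = n}

theorem OfCard.card_eq {n : ℕ} (P Q : OfCard n) :
    Nat.card P.1.carrier = Nat.card Q.1.carrier :=
  P.2.trans Q.2.symm

/-- `P ≤ Q` for plane posets of cardinality `n`: if `θ_{P,Q}(x) ≤_h θ_{P,Q}(y)` in `Q`, then
`x ≤_h y` in `P`. -/
def OfCard.BruhatLE {n : ℕ} (P Q : OfCard n) : Prop :=
  ∀ x y : P.1.carrier,
    Q.1.leH (theta P.1 Q.1 (P.card_eq Q) x) (theta P.1 Q.1 (P.card_eq Q) y) → P.1.leH x y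

theorem OfCard.bruhatLE_of_increasing {n : ℕ} {P Q : OfCard n}
    {f : P.1.carrier ≃ Q.1.carrier} (hf : Increasing P.1 Q.1 f)
    (h : ∀ x y, Q.1.leH (f x) (f y) → P.1.leH x y) : P.BruhatLE Q := by
  have := eq_theta (P.card_eq Q) hf
  subst this
  exact h

theorem OfCard.BruhatLE.trans {n : ℕ} {P Q R : OfCard n} (h : P.BruhatLE Q)
    (h' : Q.BruhatLE R) : P.BruhatLE R :=
  bruhatLE_of_increasing
    (f := (theta P.1 Q.1 (P.card_eq Q)).trans (theta Q.1 R.1 (Q.card_eq R)))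
    (fun _ _ k => theta_increasing _ _ _ _ _ (theta_increasing _ _ _ _ _ k))
    (fun _ _ k => h _ _ (h' _ _ k))

theorem OfCard.bruhatLE_of_isIso {n : ℕ} {P Q : OfCard n} {f : P.1.carrier ≃ Q.1.carrier}
    (hf : IsIso P.1 Q.1 f) : P.BruhatLE Q :=
  bruhatLE_of_increasing hf.increasing fun x y => (hf.1 x y).2

theorem OfCard.exists_isIso {n : ℕ} {P Q : OfCard n} (h : P.BruhatLE Q) (h' : Q.BruhatLE P) :
    ∃ f, IsIso P.1 Q.1 f := by
  have hθ := theta_increasing P.1 Q.1 (P.card_eq Q)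
  have hs : Increasing Q.1 P.1 (theta P.1 Q.1 (P.card_eq Q)).symm := fun x y k => by
    rw [← hθ.le_iff]; simpa using k
  have he := eq_theta (Q.card_eq P) hs
  have key : ∀ x y, P.1.leH x y ↔ Q.1.leH (theta P.1 Q.1 (P.card_eq Q) x)
      (theta P.1 Q.1 (P.card_eq Q) y) := by
    refine fun x y => ⟨fun k => h' _ _ ?_, h x y⟩
    rw [← he]; simpa using k
  refine ⟨_, key, fun x y => ?_⟩
  by_cases hxy : x = y
  · subst hxy; exact ⟨fun _ => Q.1.leR_refl _, fun _ => P.1.leR_refl _⟩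
  · have hne := (theta P.1 Q.1 (P.card_eq Q)).injective.ne hxy
    constructor
    · intro k
      rcases hθ _ _ (Or.inr k) with k' | k'
      · exact absurd (P.1.eq_of_comparable (Or.inl (h _ _ k')) (Or.inl k)) hxy
      · exact k'
    · intro k
      rcases (hθ.le_iff _ _).1 (Or.inr k) with k' | k'
      · exact absurd (Q.1.eq_of_comparable (Or.inl ((key _ _).1 k')) (Or.inl k)) hne
      · exact k'

/-- Isomorphism of plane posets of cardinality `n`. -/
instance OfCard.setoid (n : ℕ) : Setoid (OfCard n) where
  r P Q := ∃ f, IsIso P.1 Q.1 f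
  iseqv :=
    { refl := fun _ => ⟨Equiv.refl _, fun _ _ => Iff.rfl, fun _ _ => Iff.rfl⟩
      symm := fun ⟨_, hf⟩ => ⟨_, hf.symm⟩
      trans := fun ⟨_, hf⟩ ⟨_, hg⟩ => ⟨_, hf.trans hg⟩ }

end PlanePoset

/-- The set of isoclasses of plane posets of cardinality `n`. -/
def PP (n : ℕ) : Type 1 := Quotient (PlanePoset.OfCard.setoid n)

/-- The partial order on the isoclasses of plane posets of cardinality `n`. -/
instance PP.partialOrder (n : ℕ) : PartialOrder (PP n) where
  le := Quotient.lift₂ (fun P Q => P.BruhatLE Q) (by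
    rintro P Q P' Q' ⟨f, hf⟩ ⟨g, hg⟩
    refine propext ⟨fun h => ?_, fun h => ?_⟩
    · exact (PlanePoset.OfCard.bruhatLE_of_isIso hf.symm).trans
        (h.trans (PlanePoset.OfCard.bruhatLE_of_isIso hg))
    · exact (PlanePoset.OfCard.bruhatLE_of_isIso hf).trans
        (h.trans (PlanePoset.OfCard.bruhatLE_of_isIso hg.symm)))
  le_refl := by
    rintro ⟨P⟩
    exact PlanePoset.OfCard.bruhatLE_of_isIso (f := Equiv.refl _)
      ⟨fun _ _ => Iff.rfl, fun _ _ => Iff.rfl⟩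
  le_trans := by
    rintro ⟨P⟩ ⟨Q⟩ ⟨R⟩ h h'
    exact PlanePoset.OfCard.BruhatLE.trans (P := P) (Q := Q) (R := R) h h'
  le_antisymm := by
    rintro ⟨P⟩ ⟨Q⟩ h h'
    exact Quotient.sound (PlanePoset.OfCard.exists_isIso (P := P) (Q := Q) h h')

/-- The isoclass consists of plane forests. -/
def PP.IsForest {n : ℕ} : PP n → Prop :=
  Quotient.lift (fun P => P.1.IsForest) (by
    rintro P Q ⟨f, hf⟩
    exact propext ⟨hf.isForest, hf.symm.isForest⟩)

/-- The set of (isoclasses of) plane forests of degree `n`, with the restriction of the order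
of `PP n`. -/
abbrev PF (n : ℕ) : Type 1 := {P : PP n // P.IsForest}

/-- One right rotation, `((a, b), c) ↦ (a, (b, c))`, at some internal vertex of a plane binary
tree. -/
inductive RightRotation : BinaryTree Unit → BinaryTree Unit → Prop
  | root (a b c : BinaryTree Unit) :
      RightRotation (.node () (.node () a b) c) (.node () a (.node () b c))
  | left {a a' : BinaryTree Unit} (b : BinaryTree Unit) :
      RightRotation a a' → RightRotation (.node () a b) (.node () a' b)
  | right (a : BinaryTree Unit) {b b' : BinaryTree Unit} :
      RightRotation b b' → RightRotation (.node () a b) (.node () a b')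

/-- The sum of the sizes of the left subtrees at all internal vertices. -/
def leftWeight : BinaryTree Unit → ℕ
  | .nil => 0
  | .node _ a b => a.numNodes + leftWeight a + leftWeight b

theorem RightRotation.numNodes_eq {s t : BinaryTree Unit} (h : RightRotation s t) :
    s.numNodes = t.numNodes := by
  induction h with
  | root a b c => simp only [BinaryTree.numNodes]; omega
  | left b _ ih => simp only [BinaryTree.numNodes]; omega
  | right a _ ih => simp only [BinaryTree.numNodes]; omega

theorem RightRotation.leftWeight_lt {s t : BinaryTree Unit} (h : RightRotation s t) :
    leftWeight t < leftWeight s := by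
  induction h with
  | root a b c => simp only [leftWeight, BinaryTree.numNodes]; omega
  | left b h ih => have := h.numNodes_eq; simp only [leftWeight]; omega
  | right a _ ih => simp only [leftWeight]; omega

/-- Plane binary trees with `n` internal vertices (equivalently, with `n + 1` leaves). -/
def Tamari (n : ℕ) : Type := {t : BinaryTree Unit // t.numNodes = n}

/-- The Tamari order: `s ≤ t` if `t` is obtained from `s` by finitely many right rotations. -/
instance Tamari.partialOrder (n : ℕ) : PartialOrder (Tamari n) where
  le s t := Relation.ReflTransGen RightRotation s.1 t.1
  le_refl _ := Relation.ReflTransGen.refl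
  le_trans _ _ _ := Relation.ReflTransGen.trans
  le_antisymm s t h h' := by
    have key : ∀ {a b : BinaryTree Unit}, Relation.ReflTransGen RightRotation a b →
        leftWeight b ≤ leftWeight a := by
      intro a b hab
      induction hab with
      | refl => exact le_rfl
      | tail _ hr ih => exact hr.leftWeight_lt.le.trans ih
    rcases Relation.ReflTransGen.cases_head h with e | ⟨c, hc, hct⟩
    · exact Subtype.ext e
    · have h1 := hc.leftWeight_lt
      have h2 := key hct
      have h3 := key h'
      omega

/-! Both posets are encoded by the same integer sequences, the bracket vectors, under the reversed
pointwise order. Number a plane poset by its total order. Avoiding the wedge means that the elements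
above `i` for `≤_h` form an interval `[i, i + v i]` (`IsForest.leH_of_le`); transitivity of `≤_h`
makes these intervals nested or disjoint. The increasing bijection is then the identity of `Fin n`,
and inclusion of `≤_h`-relations is a pointwise comparison of vectors (`bruhatLE_iff`). For a tree
listed from right to left, a vertex and its left subtree occupy `[i, i + v i]`. A rotation lowers a
single entry. Conversely, a nested vector strictly below that of `s` stays below that of some
rotation of `s` (`exists_rightRotation`). Iterating this identifies the Tamari order with the
pointwise one; started at the left comb, whose vector is the largest, it reaches every bracket
vector. -/

/-! ### Bracket vectors of binary trees -/

/-- A sequence `v` supported on `{0, …, n - 1}` such that the intervals `[i, i + v i]` with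
`i < n` are contained in `{0, …, n - 1}` and are pairwise nested or disjoint. -/
structure IsBracketVector (n : ℕ) (v : ℕ → ℕ) : Prop where
  add_lt : ∀ i, i < n → i + v i < n
  eq_zero : ∀ i, n ≤ i → v i = 0
  nested : ∀ i k, i ≤ k → k ≤ i + v i → k + v k ≤ i + v i

/-- The sizes of the left subtrees at the vertices of a plane binary tree, where the vertices are
listed from right to left. -/
def bracketVector : BinaryTree Unit → ℕ → ℕ
  | .nil, _ => 0
  | .node _ a b, i =>
    if i < b.numNodes then bracketVector b i
    else if i = b.numNodes then a.numNodes
    else bracketVector a (i - b.numNodes - 1)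

section bracketVector
variable (a b : BinaryTree Unit)

theorem bracketVector_node_of_lt {i : ℕ} (h : i < b.numNodes) :
    bracketVector (.node () a b) i = bracketVector b i := by
  simp [bracketVector, h]

theorem bracketVector_node_root :
    bracketVector (.node () a b) b.numNodes = a.numNodes := by
  simp [bracketVector]

theorem bracketVector_node_add (i : ℕ) :
    bracketVector (.node () a b) (b.numNodes + 1 + i) = bracketVector a i := by
  have h1 : ¬ b.numNodes + 1 + i < b.numNodes := by omega
  have h2 : ¬ b.numNodes + 1 + i = b.numNodes := by omega
  have h3 : b.numNodes + 1 + i - b.numNodes - 1 = i := by omega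
  simp only [bracketVector, h1, h2, h3, if_false]

end bracketVector

/-- An index of a vertex of `node a b` lies in `b`, is the root, or lies in `a`. -/
theorem index_cases (m i : ℕ) : i < m ∨ i = m ∨ ∃ j, i = m + 1 + j := by
  rcases lt_trichotomy i m with h | h | h
  · exact Or.inl h
  · exact Or.inr (Or.inl h)
  · exact Or.inr (Or.inr ⟨i - m - 1, by omega⟩)

/-- Comparison with the vector of a node splits into blocks: right subtree, root, left subtree. The
first block needs its bound on `i`, as `bracketVector b` vanishes beyond it. -/
theorem bracketVector_node_le_iff (a b : BinaryTree Unit) (v : ℕ → ℕ) :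
    v ≤ bracketVector (.node () a b) ↔
      (∀ i < b.numNodes, v i ≤ bracketVector b i) ∧ v b.numNodes ≤ a.numNodes ∧
        (fun i => v (b.numNodes + 1 + i)) ≤ bracketVector a := by
  constructor
  · intro h
    refine ⟨fun i hi => ?_, ?_, fun i => ?_⟩
    · exact (h i).trans_eq (bracketVector_node_of_lt a b hi)
    · exact (h _).trans_eq (bracketVector_node_root a b)
    · exact (h _).trans_eq (bracketVector_node_add a b i)
  · rintro ⟨h1, h2, h3⟩ i
    rcases index_cases b.numNodes i with hi | rfl | ⟨j, rfl⟩
    · exact (h1 i hi).trans_eq (bracketVector_node_of_lt a b hi).symm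
    · exact h2.trans_eq (bracketVector_node_root a b).symm
    · exact (h3 j).trans_eq (bracketVector_node_add a b j).symm

theorem isBracketVector_bracketVector (t : BinaryTree Unit) :
    IsBracketVector t.numNodes (bracketVector t) := by
  induction t with
  | nil => exact ⟨by simp [bracketVector], by simp [bracketVector], by simp [bracketVector]⟩
  | node u a b iha ihb =>
    obtain rfl : u = () := rfl
    have hn : (BinaryTree.node () a b).numNodes = a.numNodes + b.numNodes + 1 := rfl
    rw [hn]
    have hroot := bracketVector_node_root a b
    refine ⟨fun i hi => ?_, fun i hi => ?_, fun i k hik hk => ?_⟩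
    · rcases index_cases b.numNodes i with h | rfl | ⟨j, rfl⟩
      · rw [bracketVector_node_of_lt a b h]
        have := ihb.add_lt i h
        omega
      · omega
      · rw [bracketVector_node_add]
        have := iha.add_lt j (by omega)
        omega
    · obtain ⟨j, rfl⟩ : ∃ j, i = b.numNodes + 1 + j := ⟨i - (b.numNodes + 1), by omega⟩
      rw [bracketVector_node_add]
      exact iha.eq_zero j (by omega)
    · rcases index_cases b.numNodes i with h | rfl | ⟨j, rfl⟩
      · rw [bracketVector_node_of_lt a b h] at hk ⊢
        have := ihb.add_lt i h
        rw [bracketVector_node_of_lt a b (by omega)]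
        exact ihb.nested i k hik hk
      · rcases hik.eq_or_lt with rfl | h
        · rfl
        · obtain ⟨l, rfl⟩ : ∃ l, k = b.numNodes + 1 + l := ⟨k - (b.numNodes + 1), by omega⟩
          rw [bracketVector_node_add]
          have := iha.add_lt l (by omega)
          omega
      · obtain ⟨l, rfl⟩ : ∃ l, k = b.numNodes + 1 + l := ⟨k - (b.numNodes + 1), by omega⟩
        rw [bracketVector_node_add] at hk ⊢
        rw [bracketVector_node_add]
        have := iha.nested j l (by omega) (by omega)
        omega

/-- The root is the first vertex whose interval reaches the last index, so the vector and the size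
determine both subtree sizes, and induction applies. -/
theorem bracketVector_injective {s t : BinaryTree Unit} (hn : s.numNodes = t.numNodes)
    (h : bracketVector s = bracketVector t) : s = t := by
  induction s generalizing t with
  | nil =>
    cases t with
    | nil => rfl
    | node u a b => simp [BinaryTree.numNodes] at hn
  | node u a b iha ihb =>
    cases t with
    | nil => simp [BinaryTree.numNodes] at hn
    | node u' a' b' =>
      simp only [BinaryTree.numNodes] at hn
      have hb : b.numNodes = b'.numNodes := by
        rcases lt_trichotomy b.numNodes b'.numNodes with hlt | heq | hlt
        · have h1 := congrFun h b.numNodes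
          rw [bracketVector_node_root, bracketVector_node_of_lt a' b' hlt] at h1
          have := (isBracketVector_bracketVector b').add_lt _ hlt
          omega
        · exact heq
        · have h1 := congrFun h b'.numNodes
          rw [bracketVector_node_root, bracketVector_node_of_lt a b hlt] at h1
          have := (isBracketVector_bracketVector b).add_lt _ hlt
          omega
      have ha : a = a' := iha (by omega) (funext fun i => by
        rw [← bracketVector_node_add a b, ← bracketVector_node_add a' b', ← hb]
        exact congrFun h _)
      have hb' : b = b' := ihb hb (funext fun i => by
        rcases lt_or_ge i b.numNodes with hi | hi
        · rw [← bracketVector_node_of_lt a b hi, ← bracketVector_node_of_lt a' b' (hb ▸ hi)]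
          exact congrFun h _
        · rw [(isBracketVector_bracketVector b).eq_zero i hi,
            (isBracketVector_bracketVector b').eq_zero i (hb ▸ hi)])
      subst ha hb'
      rfl

/-! ### Rotations and the pointwise order -/

/-- A rotation at the root changes the bracket vector at one place only. -/
theorem bracketVector_rotation_of_ne (a b c : BinaryTree Unit) {i : ℕ} (hi : i ≠ c.numNodes) :
    bracketVector (.node () a (.node () b c)) i =
      bracketVector (.node () (.node () a b) c) i := by
  have hn : (BinaryTree.node () b c).numNodes = b.numNodes + c.numNodes + 1 := rfl
  rcases index_cases c.numNodes i with h | h | ⟨j, rfl⟩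
  · rw [bracketVector_node_of_lt _ _ (by omega), bracketVector_node_of_lt _ _ h,
      bracketVector_node_of_lt _ _ h]
  · exact absurd h hi
  · rw [bracketVector_node_add]
    rcases index_cases b.numNodes j with h | rfl | ⟨k, rfl⟩
    · rw [bracketVector_node_of_lt _ _ (by omega), bracketVector_node_add,
        bracketVector_node_of_lt _ _ h]
    · rw [bracketVector_node_root, ← bracketVector_node_root a (.node () b c)]
      congr 1
      omega
    · rw [bracketVector_node_add, ← bracketVector_node_add a (.node () b c)]
      congr 1
      omega

theorem bracketVector_rotation_self (a b c : BinaryTree Unit) :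
    bracketVector (.node () a (.node () b c)) c.numNodes = b.numNodes := by
  have hn : (BinaryTree.node () b c).numNodes = b.numNodes + c.numNodes + 1 := rfl
  rw [bracketVector_node_of_lt _ _ (by omega), bracketVector_node_root]

theorem RightRotation.bracketVector_le {s t : BinaryTree Unit} (h : RightRotation s t) :
    bracketVector t ≤ bracketVector s := by
  induction h with
  | root a b c =>
    intro i
    by_cases hi : i = c.numNodes
    · subst hi
      rw [bracketVector_rotation_self, bracketVector_node_root]
      simp only [BinaryTree.numNodes]
      omega
    · exact (bracketVector_rotation_of_ne a b c hi).le
  | @left a a' b h ih =>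
    rw [bracketVector_node_le_iff]
    refine ⟨fun i hi => (bracketVector_node_of_lt a' b hi).le, ?_, fun i => ?_⟩
    · rw [bracketVector_node_root, h.numNodes_eq]
    · exact (bracketVector_node_add a' b i).trans_le (ih i)
  | @right a b b' h ih =>
    have hb := h.numNodes_eq
    rw [bracketVector_node_le_iff, hb]
    refine ⟨fun i hi => (bracketVector_node_of_lt a b' hi).trans_le (ih i),
      (bracketVector_node_root a b').le, fun i => (bracketVector_node_add a b' i).le⟩

/-- If a bracket vector lies strictly below that of `s`, then some rotation of `s` stays above
it. -/
theorem exists_rightRotation {s : BinaryTree Unit} {v : ℕ → ℕ}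
    (hv : ∀ i k, i ≤ k → k ≤ i + v i → k + v k ≤ i + v i)
    (h : v ≤ bracketVector s) (hne : v ≠ bracketVector s) :
    ∃ t, RightRotation s t ∧ v ≤ bracketVector t := by
  induction s generalizing v with
  | nil => exact absurd (le_antisymm h fun i => Nat.zero_le _) hne
  | node u a b iha ihb =>
    obtain rfl : u = () := rfl
    obtain ⟨h1, h2, h3⟩ := (bracketVector_node_le_iff a b v).1 h
    -- Rotate inside `a` if `v` differs there, otherwise at the root if it differs there, otherwise
    -- inside `b`. A root rotation is safe only once `v` agrees with the vector of `a`.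
    by_cases ha : (fun i => v (b.numNodes + 1 + i)) = bracketVector a
    · rcases h2.lt_or_eq with hlt | heq
      · cases a with
        | nil => simp [BinaryTree.numNodes] at hlt
        | node u a₁ a₂ =>
          have hn : (BinaryTree.node u a₁ a₂).numNodes = a₁.numNodes + a₂.numNodes + 1 := rfl
          refine ⟨_, RightRotation.root a₁ a₂ b, fun i => ?_⟩
          by_cases hi : i = b.numNodes
          · subst hi
            rw [bracketVector_rotation_self]
            -- Were the root entry larger than `a₂.numNodes`, its interval would contain the root of
            -- the left subtree; nesting would then make it cover that whole subtree, against `hlt`.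
            refine Nat.le_of_not_lt fun hlt' => ?_
            have h4 : v (b.numNodes + 1 + a₂.numNodes) = a₁.numNodes :=
              (congrFun ha _).trans (bracketVector_node_root a₁ a₂)
            have h5 := hv b.numNodes (b.numNodes + 1 + a₂.numNodes) (by omega) (by omega)
            omega
          · exact (h i).trans_eq (bracketVector_rotation_of_ne a₁ a₂ b hi).symm
      -- Truncation to the block of `b` preserves nesting and is needed to lie below `bracketVector
      -- b`.
      · obtain ⟨t, ht, hvt⟩ := ihb (v := fun i => if i < b.numNodes then v i else 0)
          (fun i k hik hk => by
            split_ifs at hk ⊢ with hi hk'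
            · exact hv i k hik hk
            · omega
            · omega
            · omega)
          (fun i => by
            dsimp only
            split_ifs with hi
            · exact h1 i hi
            · exact Nat.zero_le _)
          (fun hb' => hne (funext fun i => by
            rcases index_cases b.numNodes i with hi | rfl | ⟨j, rfl⟩
            · rw [bracketVector_node_of_lt a b hi, ← hb']
              exact (if_pos hi).symm
            · rw [bracketVector_node_root, heq]
            · rw [bracketVector_node_add, ← ha]))
        refine ⟨_, RightRotation.right a ht, ?_⟩
        rw [bracketVector_node_le_iff, ← ht.numNodes_eq]
        exact ⟨fun i hi => by simpa [hi] using hvt i, h2, h3⟩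
    · obtain ⟨t, ht, hvt⟩ := iha (fun i k hik hk => by
        have := hv (b.numNodes + 1 + i) (b.numNodes + 1 + k) (by omega) (by omega)
        omega) h3 ha
      refine ⟨_, RightRotation.left b ht, ?_⟩
      rw [bracketVector_node_le_iff, ← ht.numNodes_eq]
      exact ⟨h1, h2, hvt⟩

/-- Each rotation lowers `leftWeight`, so the descent stops, and it can only stop at `v`. -/
theorem exists_reflTransGen_rightRotation {v : ℕ → ℕ}
    (hv : ∀ i k, i ≤ k → k ≤ i + v i → k + v k ≤ i + v i) (s : BinaryTree Unit)
    (h : v ≤ bracketVector s) :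
    ∃ t, Relation.ReflTransGen RightRotation s t ∧ bracketVector t = v := by
  induction hw : leftWeight s using Nat.strong_induction_on generalizing s with
  | _ w ih =>
    by_cases hne : v = bracketVector s
    · exact ⟨s, .refl, hne.symm⟩
    · obtain ⟨s', hs', hv'⟩ := exists_rightRotation hv h hne
      obtain ⟨t, ht, htv⟩ := ih _ (hw ▸ hs'.leftWeight_lt) s' hv' rfl
      exact ⟨t, .head hs' ht, htv⟩

theorem numNodes_eq_of_reflTransGen {s t : BinaryTree Unit}
    (h : Relation.ReflTransGen RightRotation s t) : s.numNodes = t.numNodes := by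
  induction h with
  | refl => rfl
  | tail _ hr ih => exact ih.trans hr.numNodes_eq

/-- Descent from `s` to the vector of `t` ends at `t` by injectivity. Equal sizes matter: the empty
tree and the one-vertex tree both have the zero vector. -/
theorem reflTransGen_rightRotation_iff {s t : BinaryTree Unit} (hn : s.numNodes = t.numNodes) :
    Relation.ReflTransGen RightRotation s t ↔ bracketVector t ≤ bracketVector s := by
  refine ⟨fun h => ?_, fun h => ?_⟩
  · clear hn
    induction h with
    | refl => exact le_rfl
    | tail _ hr ih => exact hr.bracketVector_le.trans ih
  · obtain ⟨t', ht', h'⟩ :=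
      exists_reflTransGen_rightRotation (isBracketVector_bracketVector t).nested s h
    rwa [← bracketVector_injective ((numNodes_eq_of_reflTransGen ht').symm.trans hn) h']

/-! ### Every bracket vector comes from a tree -/

/-- The left comb with `n` internal vertices. -/
def leftComb : ℕ → BinaryTree Unit
  | 0 => .nil
  | n + 1 => .node () (leftComb n) .nil

theorem numNodes_leftComb (n : ℕ) : (leftComb n).numNodes = n := by
  induction n with
  | zero => rfl
  | succ n ih => simp [leftComb, BinaryTree.numNodes, ih]

theorem bracketVector_leftComb (n i : ℕ) : bracketVector (leftComb n) i = n - 1 - i := by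
  induction n generalizing i with
  | zero => simp [leftComb, bracketVector]
  | succ n ih =>
    simp only [leftComb, bracketVector, BinaryTree.numNodes, numNodes_leftComb, ih]
    split_ifs <;> omega

theorem IsBracketVector.exists_tree {n : ℕ} {v : ℕ → ℕ} (hv : IsBracketVector n v) :
    ∃ t : BinaryTree Unit, t.numNodes = n ∧ bracketVector t = v := by
  obtain ⟨t, ht, htv⟩ := exists_reflTransGen_rightRotation hv.nested (leftComb n) (fun i => by
    rw [bracketVector_leftComb]
    rcases lt_or_ge i n with hi | hi
    · have := hv.add_lt i hi
      exact Nat.le_sub_of_add_le (by omega)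
    · rw [hv.eq_zero i hi]
      exact Nat.zero_le _)
  exact ⟨t, (numNodes_eq_of_reflTransGen ht).symm.trans (numNodes_leftComb n), htv⟩

/-! ### From bracket vectors to plane forests -/

namespace IsBracketVector
variable {n : ℕ} {v w : ℕ → ℕ}

/-- The plane poset on `Fin n` in which the elements above `i` for `≤_h` are those of
`[i, i + v i]`. -/
def planePoset (hv : IsBracketVector n v) : PlanePoset where
  carrier := Fin n
  finite := inferInstance
  leH x y := x.1 ≤ y.1 ∧ y.1 ≤ x.1 + v x
  leR x y := x = y ∨ x.1 + v x < y.1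
  partialOrderH :=
    { refl := fun x => ⟨le_rfl, by omega⟩
      trans := fun x y z h h' => by
        have := hv.nested x y h.1 h.2
        omega
      antisymm := fun x y h h' => Fin.ext (by omega) }
  partialOrderR :=
    { refl := fun x => Or.inl rfl
      trans := by
        rintro x y z (rfl | h) (rfl | h')
        · exact Or.inl rfl
        · exact Or.inr h'
        · exact Or.inr h
        · exact Or.inr (by omega)
      antisymm := by
        rintro x y (h | h) (h' | h')
        · exact h
        · exact h
        · exact h'.symm
        · omega }
  incompat x y hxy := by
    have : x.1 ≠ y.1 := fun h => hxy (Fin.ext h)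
    simp only [hxy, hxy.symm, false_or]
    omega

theorem planePoset_le_iff (hv : IsBracketVector n v) (x y : Fin n) :
    hv.planePoset.le x y ↔ x ≤ y := by
  change (x.1 ≤ y.1 ∧ y.1 ≤ x.1 + v x) ∨ (x = y ∨ x.1 + v x < y.1) ↔ x.1 ≤ y.1
  rw [Fin.ext_iff]
  omega

theorem isForest_planePoset (hv : IsBracketVector n v) : hv.planePoset.IsForest := by
  rintro ⟨f, hf, hH, hR⟩
  have h1 := (hH (0 : Fin 3) (2 : Fin 3)).1 (Or.inr rfl)
  have h2 := (hH (1 : Fin 3) (2 : Fin 3)).1 (Or.inr rfl)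
  have h3 := (hR (0 : Fin 3) (1 : Fin 3)).1 (Or.inr ⟨rfl, rfl⟩)
  rcases h3 with h3 | h3
  · exact absurd (hf h3) (by change ¬ (0 : Fin 3) = 1; decide)
  -- The image of `1` lies past the end of the interval of the image of `0`, yet does not exceed the
  -- image of `2`, which lies inside it.
  · have := h1.2
    have := h2.1
    omega

/-- The plane forest of a bracket vector, as a plane poset of cardinality `n`. -/
def ofCard (hv : IsBracketVector n v) : PlanePoset.OfCard n :=
  ⟨hv.planePoset, Nat.card_fin n⟩

theorem bruhatLE_iff (hv : IsBracketVector n v) (hw : IsBracketVector n w) :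
    hv.ofCard.BruhatLE hw.ofCard ↔ w ≤ v := by
  have hinc : PlanePoset.Increasing hv.planePoset hw.planePoset (Equiv.refl (Fin n)) :=
    fun x y h => (hw.planePoset_le_iff _ _).2 ((hv.planePoset_le_iff _ _).1 h)
  constructor
  · intro h i
    rcases lt_or_ge i n with hi | hi
    · have hlt := hw.add_lt i hi
      -- It suffices to test the right end of the interval of `i`.
      have key := h (⟨i, hi⟩ : Fin n) (⟨i + w i, hlt⟩ : Fin n)
      rw [← PlanePoset.eq_theta (hv.ofCard.card_eq hw.ofCard) hinc] at key
      have : i + w i ≤ i + v i := (key ⟨Nat.le_add_right _ _, le_rfl⟩).2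
      exact Nat.le_of_add_le_add_left this
    · rw [hw.eq_zero i hi]
      exact Nat.zero_le _
  · intro h
    refine PlanePoset.OfCard.bruhatLE_of_increasing hinc fun x y hxy => ⟨hxy.1, ?_⟩
    exact hxy.2.trans (Nat.add_le_add_left (h _) _)

end IsBracketVector

/-! ### From plane forests to bracket vectors -/

namespace PlanePoset

theorem OfCard.exists_equiv_fin {n : ℕ} (P : OfCard n) :
    ∃ e : Fin n ≃ P.1.carrier, ∀ i j, P.1.le (e i) (e j) ↔ i ≤ j := by
  let := P.1.linearOrder
  have := P.1.finite
  let := Fintype.ofFinite P.1.carrier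
  let e : Fin n ≃o P.1.carrier := Fintype.orderIsoFinOfCardEq P.1.carrier
    ((Nat.card_eq_fintype_card (α := P.1.carrier)).symm.trans P.2)
  exact ⟨e.toEquiv, fun i j => e.le_iff_le⟩

/-- Preserving both orders suffices: any two elements are already related in `P`, and a second,
conflicting relation in `Q` forces them to be equal. -/
theorem isContainedIn_of_monotone {P Q : PlanePoset} {f : P.carrier → Q.carrier}
    (hf : Function.Injective f) (hH : ∀ x y, P.leH x y → Q.leH (f x) (f y))
    (hR : ∀ x y, P.leR x y → Q.leR (f x) (f y)) : IsContainedIn P Q := by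
  refine ⟨f, hf, fun x y => ⟨hH x y, fun h => ?_⟩, fun x y => ⟨hR x y, fun h => ?_⟩⟩
  · rcases P.le_total x y with (k | k) | (k | k)
    · exact k
    · exact hf (Q.eq_of_comparable (Or.inl h) (Or.inl (hR _ _ k))) ▸ P.leH_refl x
    · exact hf (Q.partialOrderH.antisymm _ _ h (hH _ _ k)) ▸ P.leH_refl x
    · exact hf (Q.eq_of_comparable (Or.inl h) (Or.inr (hR _ _ k))) ▸ P.leH_refl x
  · rcases P.le_total x y with (k | k) | (k | k)
    · exact hf (Q.eq_of_comparable (Or.inl (hH _ _ k)) (Or.inl h)) ▸ P.leR_refl x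
    · exact k
    · exact hf (Q.eq_of_comparable (Or.inr (hH _ _ k)) (Or.inl h)) ▸ P.leR_refl x
    · exact hf (Q.partialOrderR.antisymm _ _ h (hR _ _ k)) ▸ P.leR_refl x

/-- In a plane forest, the elements above `x` for `≤_h` form an interval of the total order. -/
theorem IsForest.leH_of_le {P : PlanePoset} (hP : P.IsForest) {x y z : P.carrier}
    (hxy : P.le x y) (hyz : P.le y z) (hxz : P.leH x z) : P.leH x y := by
  by_contra hn
  have hr : P.leR x y := hxy.resolve_left hn
  have hxy' : x ≠ y := fun h => hn (h ▸ P.leH_refl x)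
  have hh : P.leH y z := by
    refine hyz.resolve_right fun h => ?_
    have := P.eq_of_comparable (Or.inl hxz) (Or.inl (P.partialOrderR.trans _ _ _ hr h))
    subst this
    exact hxy' (P.partialOrderR.antisymm _ _ hr h)
  have hxz' : x ≠ z := by
    rintro rfl
    exact hxy' (P.eq_of_comparable (Or.inr hh) (Or.inl hr))
  have hyz' : y ≠ z := by
    rintro rfl
    exact hn hxz
  -- Now `x <_r y`, `x <_h z` and `y <_h z`: a forbidden wedge.
  refine hP (isContainedIn_of_monotone (P := wedge) (f := ![x, y, z]) ?_ ?_ ?_)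
  · intro (i : Fin 3) (j : Fin 3) hij
    fin_cases i <;> fin_cases j <;> first | rfl | simp_all [eq_comm]
  · rintro (i : Fin 3) (j : Fin 3) (rfl | rfl)
    · exact P.leH_refl _
    · fin_cases i
      · exact hxz
      · exact hh
      · exact P.leH_refl _
  · rintro (i : Fin 3) (j : Fin 3) (rfl | ⟨rfl, rfl⟩)
    · exact P.leR_refl _
    · exact hr

/-- Every plane forest comes from a bracket vector. -/
theorem OfCard.exists_isIso_bracketVector {n : ℕ} (P : OfCard n) (hP : P.1.IsForest) :
    ∃ (v : ℕ → ℕ) (hv : IsBracketVector n v) (f : hv.planePoset.carrier ≃ P.1.carrier),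
      IsIso hv.planePoset P.1 f := by
  obtain ⟨e, he⟩ := P.exists_equiv_fin
  -- `d` is the last index above `i` for `≤_h`; the forest condition fills in everything between.
  have hex : ∀ i, ∃ d : Fin n, ∀ j, i ≤ j → (P.1.leH (e i) (e j) ↔ j ≤ d) := fun i => by
    obtain ⟨d, hd, hmax⟩ := Set.exists_max_image {j | P.1.leH (e i) (e j)} id (Set.toFinite _)
      ⟨i, P.1.leH_refl _⟩
    exact ⟨d, fun j hij => ⟨hmax j, fun hjd =>
      hP.leH_of_le ((he _ _).2 hij) ((he _ _).2 hjd) hd⟩⟩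
  choose d hd using hex
  have hle : ∀ i, i ≤ d i := fun i => (hd i i le_rfl).1 (P.1.leH_refl _)
  have hnest : ∀ i k, i ≤ k → k ≤ d i → d k ≤ d i := fun i k hik hk =>
    (hd i _ (hik.trans (hle k))).1 (P.1.partialOrderH.trans _ _ _ ((hd i k hik).2 hk)
      ((hd k _ (hle k)).2 le_rfl))
  let v : ℕ → ℕ := fun i => if h : i < n then (d ⟨i, h⟩).1 - i else 0
  have hvd : ∀ i : Fin n, i.1 + v i = (d i).1 := fun i => by
    have : i.1 ≤ (d i).1 := hle i
    have h : v i = (d i).1 - i := dif_pos i.2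
    omega
  have hv0 : ∀ i, n ≤ i → v i = 0 := fun i hi => dif_neg hi.not_gt
  have hv : IsBracketVector n v := by
    refine ⟨fun i hi => (hvd ⟨i, hi⟩).trans_lt (d ⟨i, hi⟩).2, hv0, fun i k hik hk => ?_⟩
    rcases lt_or_ge i n with hi | hi
    · have h1 := hvd ⟨i, hi⟩
      have hkn : k < n := (hk.trans_eq h1).trans_lt (d ⟨i, hi⟩).2
      have h2 := hvd ⟨k, hkn⟩
      dsimp only at h1 h2
      rw [h1] at hk ⊢
      rw [h2]
      exact hnest ⟨i, hi⟩ ⟨k, hkn⟩ hik hk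
    · rw [hv0 i hi, hv0 k (hi.trans hik)]
      have := hv0 i hi
      omega
  refine ⟨v, hv, e, fun (x : Fin n) (y : Fin n) => ?_, fun (x : Fin n) (y : Fin n) => ?_⟩
  · change x ≤ y ∧ y.1 ≤ x.1 + v x ↔ _
    rw [hvd]
    exact ⟨fun h => (hd x y h.1).2 h.2, fun h =>
      have hxy := (he x y).1 (Or.inl h)
      ⟨hxy, (hd x y hxy).1 h⟩⟩
  · change x = y ∨ x.1 + v x < y.1 ↔ _
    rw [hvd]
    constructor
    · rintro (rfl | h)
      · exact P.1.leR_refl _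
      · have hxy : x ≤ y := (hle x).trans (Fin.le_of_lt h)
        exact ((he x y).2 hxy).resolve_left fun k => ((hd x y hxy).1 k).not_gt h
    · intro h
      have hxy := (he x y).1 (Or.inr h)
      rcases lt_or_ge (d x) y with hlt | hge
      · exact Or.inr hlt
      · exact Or.inl (e.injective
          (P.1.eq_of_comparable (Or.inl ((hd x y hxy).2 hge)) (Or.inl h)))

end PlanePoset

/-! ### The isomorphism -/

theorem Tamari.isBracketVector {n : ℕ} (t : Tamari n) :
    IsBracketVector n (bracketVector t.1) := by
  have := isBracketVector_bracketVector t.1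
  rwa [t.2] at this

/-- The plane forest of a plane binary tree. -/
def Tamari.toForest {n : ℕ} (t : Tamari n) : PF n :=
  ⟨Quotient.mk _ t.isBracketVector.ofCard, t.isBracketVector.isForest_planePoset⟩

theorem Tamari.toForest_le_iff {n : ℕ} (s t : Tamari n) : s.toForest ≤ t.toForest ↔ s ≤ t :=
  (IsBracketVector.bruhatLE_iff s.isBracketVector t.isBracketVector).trans
    (reflTransGen_rightRotation_iff (s.2.trans t.2.symm)).symm

theorem Tamari.toForest_surjective (n : ℕ) :
    Function.Surjective (Tamari.toForest : Tamari n → PF n) := by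
  rintro ⟨⟨P⟩, hP⟩
  obtain ⟨v, hv, f, hf⟩ := P.exists_isIso_bracketVector hP
  obtain ⟨t, ht, rfl⟩ := hv.exists_tree
  exact ⟨⟨t, ht⟩, Subtype.ext (Quotient.sound ⟨f, hf⟩)⟩

theorem mainTheorem7 (n : ℕ) : Nonempty (PF n ≃o Tamari n) :=
  ⟨(RelIso.ofSurjective (OrderEmbedding.ofMapLEIff Tamari.toForest Tamari.toForest_le_iff)
    (Tamari.toForest_surjective n)).symm⟩
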